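/- Let $p$ be an odd prime, let $\varepsilon$ be a generator of $(\mathbb{Z}/p)^\times$, and let $[A]$ be a conjugacy class in $\mathrm{SL}(2,\mathbb{Z})$, with representative $A$. Let $M([A])$ be the mapping torus of $A$, that is, $(\mathbb{R}^2/\mathbb{Z}^2)\times[0,1]$ with $(x,0)$ identified with $(Ax,1)$ for all $x$ (up to homeomorphism it depends only on $[A]$), and let $$Z(M([A]),\mathbb{Z}/p)=\frac{|\operatorname{Hom}(\pi_1(M([A])),\mathbb{Z}/p)|}{|\mathbb{Z}/p|}$$ be its untwisted $\mathbb{Z}/p$ Dijkgraaf–Witten invariant. Let $\mathcal{C}1$, $\mathcal{C}3$, $\mathcal{C}4$ be the conjugacy classes in $\mathrm{SL}(2,\mathbb{Z}/p)$ of $\begin{pmatrix}1&0\\0&1\end{pmatrix}$, $\begin{pmatrix}1&1\\0&1\end{pmatrix}$, $\begin{pmatrix}1&\varepsilon\\0&1\end{pmatrix}$ respectively. Then $$Z(M([A]),\mathbb{Z}/p)=\begin{cases}p^2&\text{if } [A]\bmod p \text{ is the identity class } \mathcal{C}1,\\ p&\text{if } [A]\bmod p \text{ is one of the (nontrivial)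 unipotent classes } \mathcal{C}3 \text{ or } \mathcal{C}4,\\ 1&\text{otherwise.}\end{cases}$$ -/

import Mathlib

open scoped MatrixGroups

namespace DijkgraafWitten

section MappingTorus

/-- The generating relation `(x, 0) ∼ (f(x), 1)` on `S × [0, 1]`. -/
inductive GlueRel {S : Type*} [TopologicalSpace S] (f : S ≃ₜ S) :
    S × unitInterval → S × unitInterval → Prop
  | glue (x : S) : GlueRel f (x, 0) (f x, 1)

/-- The mapping torus `M(f) = S × [0, 1] / (x, 0) ∼ (f(x), 1)`, as a set. -/
def MappingTorus {S : Type*} [TopologicalSpace S] (f : S ≃ₜ S) : Type _ :=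
  Quot (GlueRel f)

/-- The mapping torus carries the quotient topology. -/
instance {S : Type*} [TopologicalSpace S] (f : S ≃ₜ S) : TopologicalSpace (MappingTorus f) :=
  inferInstanceAs (TopologicalSpace (Quot (GlueRel f)))

/-- The class of `(x, t)` in the mapping torus. -/
def MappingTorus.mk {S : Type*} [TopologicalSpace S] (f : S ≃ₜ S) (x : S) (t : unitInterval) :
    MappingTorus f :=
  Quot.mk (GlueRel f) (x, t)

/-- A continuous map intertwining `f` and `g` induces a continuous map of mapping tori. -/
def MappingTorus.map {S : Type*} [TopologicalSpace S] {f g : S ≃ₜ S} (h : C(S, S))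
    (comm : ∀ x, h (f x) = g (h x)) : C(MappingTorus f, MappingTorus g) where
  toFun := Quot.map (fun q => (h q.1, q.2)) (by
    rintro _ _ ⟨x⟩
    simp only [comm]
    exact GlueRel.glue (h x))
  continuous_toFun := by
    have hc : Continuous fun q : S × unitInterval => MappingTorus.mk g (h q.1) q.2 :=
      continuous_quot_mk.comp (by fun_prop : Continuous fun q : S × unitInterval => (h q.1, q.2))
    exact continuous_quot_lift _ hc

/-- The mapping torus of a homeomorphism of a path connected space is path connected, so its
fundamental group does not depend on the base point up to isomorphism. -/
instance {S : Type*} [TopologicalSpace S] [PathConnectedSpace S] (f : S ≃ₜ S) :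
    PathConnectedSpace (MappingTorus f) :=
  haveI : PathConnectedSpace unitInterval :=
    isPathConnected_iff_pathConnectedSpace.mp ((convex_Icc (0 : ℝ) 1).isPathConnected ⟨0, by simp⟩)
  haveI : PathConnectedSpace (S × unitInterval) :=
    ⟨inferInstance, fun a b => ⟨(PathConnectedSpace.somePath a.1 b.1).prod
      (PathConnectedSpace.somePath a.2 b.2)⟩⟩
  Quot.mk_surjective.pathConnectedSpace continuous_quot_mk

end MappingTorus

section Torus

/-- The two dimensional torus `(ℝ/ℤ)²`. -/
abbrev Torus : Type := Fin 2 → UnitAddCircle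

/-- The self-map `x ↦ A x` of `(ℝ/ℤ)²` induced by the linear action of `A` on `ℝ²`. -/
def torusMap (A : SL(2, ℤ)) : C(Torus, Torus) where
  toFun x := fun i => ∑ j, A i j • x j
  continuous_toFun := by fun_prop

theorem torusMap_mul (A B : SL(2, ℤ)) (x : Torus) :
    torusMap (A * B) x = torusMap A (torusMap B x) := by
  funext i
  simp only [torusMap, ContinuousMap.coe_mk, Matrix.SpecialLinearGroup.coe_mul, Matrix.mul_apply,
    Fin.sum_univ_two, smul_add, add_smul, mul_smul]
  abel

theorem torusMap_one (x : Torus) : torusMap 1 x = x := by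
  funext i
  fin_cases i <;> simp [torusMap]

theorem torusMap_zero (A : SL(2, ℤ)) : torusMap A 0 = 0 := by
  funext i
  simp [torusMap]

/-- The homeomorphism `x ↦ A x` of the torus, representing the mapping class of `A ∈ SL(2, ℤ)`. -/
def torusHomeo (A : SL(2, ℤ)) : Torus ≃ₜ Torus where
  toFun := torusMap A
  invFun := torusMap A⁻¹
  left_inv x := by rw [← torusMap_mul, inv_mul_cancel, torusMap_one]
  right_inv x := by rw [← torusMap_mul, mul_inv_cancel, torusMap_one]
  continuous_toFun := (torusMap A).continuous
  continuous_invFun := (torusMap A⁻¹).continuous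

/-- The three dimensional mapping torus `M(A)` of `A ∈ SL(2, ℤ)`. -/
abbrev TorusBundle (A : SL(2, ℤ)) : Type := MappingTorus (torusHomeo A)

/-- The base point of `M(A)`, the class of `(0, 0)`. -/
def TorusBundle.base (A : SL(2, ℤ)) : TorusBundle A := MappingTorus.mk (torusHomeo A) 0 0

end Torus

section Invariant

/-- The untwisted Dijkgraaf–Witten invariant `|Hom(π₁(M), G)| / |G|` of a space `M` with base
point `x`, for a finite group `G`. -/
noncomputable def invariant (M : Type*) [TopologicalSpace M] (x : M) (G : Type*) [Group G] : ℚ :=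
  (Nat.card (FundamentalGroup M x →* G) : ℚ) / (Nat.card G : ℚ)

theorem invariant_congr {M N : Type*} [TopologicalSpace M] [TopologicalSpace N] (e : M ≃ₜ N)
    (x : M) (y : N) (hxy : e x = y) (G : Type*) [Group G] :
    invariant M x G = invariant N y G := by
  subst hxy
  have E : FundamentalGroup M x ≃* FundamentalGroup N (e x) :=
    (FundamentalGroupoidFunctor.equivOfHomotopyEquiv
      e.toHomotopyEquiv).fullyFaithfulFunctor.mulEquivEnd (FundamentalGroupoid.mk x)
  unfold invariant
  rw [Nat.card_congr E.monoidHomCongrLeftEquiv]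

/-- Conjugate matrices have homeomorphic mapping tori. -/
def TorusBundle.conjHomeo (A C : SL(2, ℤ)) : TorusBundle A ≃ₜ TorusBundle (C * A * C⁻¹) where
  toFun := MappingTorus.map (torusMap C) fun x => by
    change torusMap C (torusMap A x) = torusMap (C * A * C⁻¹) (torusMap C x)
    simp only [← torusMap_mul, inv_mul_cancel_right]
  invFun := MappingTorus.map (torusMap C⁻¹) fun x => by
    change torusMap C⁻¹ (torusMap (C * A * C⁻¹) x) = torusMap A (torusMap C⁻¹ x)
    simp only [← torusMap_mul, mul_assoc, inv_mul_cancel_left]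
  left_inv := by
    rintro ⟨x, t⟩
    change Quot.mk _ (torusMap C⁻¹ (torusMap C x), t) = _
    rw [← torusMap_mul, inv_mul_cancel, torusMap_one]
  right_inv := by
    rintro ⟨x, t⟩
    change Quot.mk _ (torusMap C (torusMap C⁻¹ x), t) = _
    rw [← torusMap_mul, mul_inv_cancel, torusMap_one]
  continuous_toFun := ContinuousMap.continuous _
  continuous_invFun := ContinuousMap.continuous _

theorem TorusBundle.conjHomeo_base (A C : SL(2, ℤ)) :
    TorusBundle.conjHomeo A C (TorusBundle.base A) = TorusBundle.base (C * A * C⁻¹) := by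
  change Quot.mk _ (torusMap C 0, (0 : unitInterval)) = Quot.mk _ (0, 0)
  rw [torusMap_zero]

/-- The invariant `Z(M([A]), ℤ/p)` of a conjugacy class `[A]` of `SL(2, ℤ)`: the untwisted
invariant, with group `ℤ/p`, of the mapping torus `M(A)` of any representative `A`. -/
noncomputable def Z (p : ℕ) : ConjClasses SL(2, ℤ) → ℚ :=
  Quotient.lift
    (fun A => invariant (TorusBundle A) (TorusBundle.base A) (Multiplicative (ZMod p))) (by
      intro A B h
      obtain ⟨C, rfl⟩ := isConj_iff.mp (show IsConj A B from h)
      exact invariant_congr (TorusBundle.conjHomeo A C) _ _ (TorusBundle.conjHomeo_base A C) _)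

end Invariant

section Classes

/-- Reduction mod `p` of a conjugacy class of `SL(2, ℤ)`, a conjugacy class of `SL(2, ℤ/p)`. -/
def reduceMod (p : ℕ) : ConjClasses SL(2, ℤ) → ConjClasses SL(2, ZMod p) :=
  ConjClasses.map (Matrix.SpecialLinearGroup.map (Int.castRingHom (ZMod p)))

/-- The upper unitriangular matrix with upper right entry `b`. -/
def unitriangular {R : Type*} [CommRing R] (b : R) : SL(2, R) :=
  ⟨!![1, b; 0, 1], by simp [Matrix.det_fin_two]⟩

/-- The class of the identity matrix. -/
def C1 (p : ℕ) : ConjClasses SL(2, ZMod p) := ConjClasses.mk 1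

/-- The class of `(1 1; 0 1)`. -/
def C3 (p : ℕ) : ConjClasses SL(2, ZMod p) := ConjClasses.mk (unitriangular 1)

/-- The class of `(1 ε; 0 1)`; here `ε` is meant to be a generator of `(ℤ/p)ˣ`. -/
def C4 (p : ℕ) (ε : (ZMod p)ˣ) : ConjClasses SL(2, ZMod p) :=
  ConjClasses.mk (unitriangular (ε : ZMod p))

end Classes

end DijkgraafWitten

/-!
The torus bundle `M(A)` is the quotient of `ℝ² × ℝ` by the group `Γ = ℤ² ⋊ ℤ`, where the generator
of `ℤ` acts on `ℤ²` by `A`, and `(w, n)` moves `(v, t)` to `(Aⁿ v + w, t + n)`.  The quotient map is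
the covering map `TorusBundle.cover`, and `ℝ² × ℝ` is simply connected, so `π₁(M(A))` is isomorphic
to the opposite group of `Γ` (`TorusBundle.isQuotientCoveringMap_cover`).

A homomorphism from `Γ` to the abelian group `ℤ/p` is a row vector `a` over `ℤ/p` with `a A = a`,
giving the values on `ℤ²`, together with an arbitrary value on the generator of `ℤ`.  Hence
`Z(M(A), ℤ/p)` is the number of row vectors over `ℤ/p` that `A mod p` fixes (`Z_mk`).

This number depends only on the conjugacy class of `A mod p`; it is `p²` for the identity and `p`
for a unitriangular matrix with non-zero corner.  If `A mod p` fixes a non-zero row vector, taking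
that vector as the second row of a matrix `P` of determinant one makes `P A P⁻¹` unitriangular,
and conjugation by diagonal matrices changes the corner by squares.  Since every unit is a square
or `ε` times a square, `A mod p` then lies in `C1`, `C3` or `C4`
(`mk_eq_of_vecMul_eq_self`).  In all other cases only the zero vector is fixed.
-/

namespace DijkgraafWitten

/-! ### The action of `SL(2, ℤ)` on column vectors -/

section LinearAction

variable {R : Type*} [CommRing R]

/-- The action of `A ∈ SL(2, ℤ)` on column vectors over a commutative ring. -/
def linAct (A : SL(2, ℤ)) (v : Fin 2 → R) : Fin 2 → R :=
  (Matrix.SpecialLinearGroup.map (Int.castRingHom R) A : Matrix (Fin 2) (Fin 2) R).mulVec v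

theorem linAct_one (v : Fin 2 → R) : linAct 1 v = v := by
  simp [linAct]

theorem linAct_mul (A B : SL(2, ℤ)) (v : Fin 2 → R) :
    linAct (A * B) v = linAct A (linAct B v) := by
  simp only [linAct, map_mul, Matrix.SpecialLinearGroup.coe_mul, Matrix.mulVec_mulVec]

theorem linAct_add (A : SL(2, ℤ)) (v w : Fin 2 → R) :
    linAct A (v + w) = linAct A v + linAct A w :=
  Matrix.mulVec_add _ _ _

theorem linAct_apply (A : SL(2, ℤ)) (v : Fin 2 → R) (i : Fin 2) :
    linAct A v i = (A i 0 : R) * v 0 + (A i 1 : R) * v 1 := by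
  simp [linAct, Matrix.mulVec, dotProduct, Fin.sum_univ_two]

theorem linAct_intCast (A : SL(2, ℤ)) (w : Fin 2 → ℤ) :
    linAct A (fun i => (w i : R)) = fun i => ((linAct A w i : ℤ) : R) := by
  funext i
  simp [linAct_apply]

theorem continuous_linAct (A : SL(2, ℤ)) : Continuous (linAct A : (Fin 2 → ℝ) → Fin 2 → ℝ) :=
  Continuous.matrix_mulVec continuous_const continuous_id

/-- The projection `ℝ² → (ℝ/ℤ)²`. -/
def torusProj (v : Fin 2 → ℝ) : Torus := fun i => (v i : UnitAddCircle)

theorem isOpenQuotientMap_torusProj : IsOpenQuotientMap torusProj :=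
  IsOpenQuotientMap.piMap fun _ => QuotientAddGroup.isOpenQuotientMap_mk

theorem torusProj_linAct (A : SL(2, ℤ)) (v : Fin 2 → ℝ) :
    torusProj (linAct A v) = torusMap A (torusProj v) := by
  funext i
  simp [torusProj, torusMap, linAct_apply, Fin.sum_univ_two, ← zsmul_eq_mul]

theorem torusProj_eq_iff {v v' : Fin 2 → ℝ} :
    torusProj v = torusProj v' ↔ ∃ w : Fin 2 → ℤ, v = v' + fun i => (w i : ℝ) := by
  constructor
  · intro h
    have h' : ∀ i, ∃ n : ℤ, v i = v' i + n := fun i => by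
      have hi : ((v i - v' i : ℝ) : UnitAddCircle) = 0 := by
        rw [AddCircle.coe_sub, sub_eq_zero]
        exact congrFun h i
      obtain ⟨n, hn⟩ := (AddCircle.coe_eq_zero_iff (1 : ℝ)).mp hi
      refine ⟨n, ?_⟩
      rw [zsmul_eq_mul, mul_one] at hn
      linarith
    choose w hw using h'
    exact ⟨w, funext hw⟩
  · rintro ⟨w, rfl⟩
    funext i
    simp [torusProj]

end LinearAction

/-! ### The deck group and its action on `ℝ² × ℝ` -/

section DeckGroup

/-- `SL(2, ℤ)` acting on the lattice `ℤ²`, written multiplicatively. -/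
def latticeAut : SL(2, ℤ) →* MulAut (Multiplicative (Fin 2 → ℤ)) where
  toFun A :=
    { toFun := fun w => .ofAdd (linAct A w.toAdd)
      invFun := fun w => .ofAdd (linAct A⁻¹ w.toAdd)
      left_inv := fun w => by simp [← linAct_mul, linAct_one]
      right_inv := fun w => by simp [← linAct_mul, linAct_one]
      map_mul' := fun v w => by simp [linAct_add] }
  map_one' := by ext1 w; simp [linAct_one]
  map_mul' A B := by ext1 w; simp [linAct_mul]

/-- The group `ℤ² ⋊ ℤ` in which the generator of `ℤ` acts on `ℤ²` by `A`. -/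
abbrev DeckGroup (A : SL(2, ℤ)) : Type :=
  Multiplicative (Fin 2 → ℤ) ⋊[latticeAut.comp (zpowersHom _ A)] Multiplicative ℤ

theorem latticeAut_zpowersHom (A : SL(2, ℤ)) (n : Multiplicative ℤ)
    (w : Multiplicative (Fin 2 → ℤ)) :
    latticeAut.comp (zpowersHom _ A) n w = .ofAdd (linAct (A ^ n.toAdd) w.toAdd) := rfl

/-- The element `(w, n)` of `ℤ² ⋊ ℤ` moves `(v, t)` to `(Aⁿ v + w, t + n)`. -/
instance (A : SL(2, ℤ)) : MulAction (DeckGroup A) ((Fin 2 → ℝ) × ℝ) where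
  smul g e := (linAct (A ^ g.right.toAdd) e.1 + fun i => (g.left.toAdd i : ℝ),
    e.2 + (g.right.toAdd : ℝ))
  one_smul e := by
    refine Prod.ext (funext fun i => ?_) ?_
    · change linAct (A ^ (0 : ℤ)) e.1 i + ((0 : ℤ) : ℝ) = _
      simp [linAct_one]
    · change e.2 + ((0 : ℤ) : ℝ) = _
      simp
  mul_smul g h e := by
    refine Prod.ext ?_ ?_
    · change linAct (A ^ (g.right.toAdd + h.right.toAdd)) e.1 +
          (fun i => ((g.left.toAdd i + linAct (A ^ g.right.toAdd) h.left.toAdd i : ℤ) : ℝ)) =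
        linAct (A ^ g.right.toAdd) (linAct (A ^ h.right.toAdd) e.1 + fun i => (h.left.toAdd i : ℝ))
          + fun i => (g.left.toAdd i : ℝ)
      rw [zpow_add, linAct_mul, linAct_add, linAct_intCast]
      funext i
      simp only [Pi.add_apply, Int.cast_add]
      ring
    · change e.2 + ((g.right.toAdd + h.right.toAdd : ℤ) : ℝ) = e.2 + h.right.toAdd + g.right.toAdd
      push_cast
      ring

theorem DeckGroup.smul_def {A : SL(2, ℤ)} (g : DeckGroup A) (e : (Fin 2 → ℝ) × ℝ) :
    g • e = (linAct (A ^ g.right.toAdd) e.1 + fun i => (g.left.toAdd i : ℝ),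
      e.2 + (g.right.toAdd : ℝ)) := rfl

/-- The deck group moves the open box of side one around any point off itself: the height of a
point changes by an integer, and if that integer vanishes the group element is a translation by an
integral vector. -/
theorem DeckGroup.eq_one_of_dist_lt {A : SL(2, ℤ)} {g : DeckGroup A} {e x : (Fin 2 → ℝ) × ℝ}
    (hx : dist x e < 1 / 2) (hgx : dist (g • x) e < 1 / 2) : g = 1 := by
  have hlt : dist (g • x) x < 1 := by
    have := dist_triangle_right (g • x) x e
    linarith
  rw [smul_def, Prod.dist_eq, max_lt_iff] at hlt
  have hr : g.right.toAdd = 0 := by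
    have h := hlt.2
    simp only [dist_self_add_left, Real.norm_eq_abs] at h
    exact Int.abs_lt_one_iff.mp (by exact_mod_cast h)
  have hl : g.left.toAdd = 0 := by
    funext i
    have h := lt_of_le_of_lt (dist_le_pi_dist _ _ i) hlt.1
    simp only [hr, zpow_zero, linAct_one, Pi.add_apply, dist_self_add_left,
      Real.norm_eq_abs] at h
    exact Int.abs_lt_one_iff.mp (by exact_mod_cast h)
  exact SemidirectProduct.ext hl hr

end DeckGroup

/-! ### The universal covering of the torus bundle -/

section Covering

/-- The fractional part, as a point of the unit interval. -/
noncomputable def unitFract (t : ℝ) : unitInterval :=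
  ⟨Int.fract t, Int.fract_nonneg t, (Int.fract_lt_one t).le⟩

theorem torusHomeo_apply (A : SL(2, ℤ)) (x : Torus) : torusHomeo A x = torusMap A x := rfl

theorem MappingTorus.mk_zero {S : Type*} [TopologicalSpace S] (f : S ≃ₜ S) (x : S) :
    MappingTorus.mk f x 0 = MappingTorus.mk f (f x) 1 :=
  Quot.sound (GlueRel.glue x)

open Classical in
/-- The representative of a point of a mapping torus whose second coordinate is not `1`. -/
noncomputable def MappingTorus.normalForm {S : Type*} [TopologicalSpace S] (f : S ≃ₜ S) :
    MappingTorus f → S × unitInterval :=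
  Quot.lift (fun q => if q.2 = 1 then (f.symm q.1, 0) else q) (by
    rintro _ _ ⟨x⟩
    simp)

theorem MappingTorus.normalForm_mk {S : Type*} [TopologicalSpace S] (f : S ≃ₜ S) (x : S)
    {t : unitInterval} (ht : t ≠ 1) : normalForm f (mk f x t) = (x, t) :=
  if_neg ht

namespace TorusBundle

variable (A : SL(2, ℤ))

/-- The covering map `ℝ² × ℝ → M(A)`.  On `ℝ² × [0, 1]` it is the evident projection, and it is
extended so as to be invariant under `(v, t) ↦ (A v, t + 1)`. -/
noncomputable def cover (e : (Fin 2 → ℝ) × ℝ) : TorusBundle A :=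
  MappingTorus.mk (torusHomeo A) (torusMap (A ^ (-⌊e.2⌋)) (torusProj e.1)) (unitFract e.2)

/-- The formula for the covering map on the closed slab `ℝ² × [n, n + 1]`: the formulas of adjacent
slabs agree on the common face because of the gluing. -/
theorem cover_add (v : Fin 2 → ℝ) (n : ℤ) (s : unitInterval) :
    cover A (v, n + s) =
      MappingTorus.mk (torusHomeo A) (torusMap (A ^ (-n)) (torusProj v)) s := by
  rcases s.2.2.lt_or_eq with hs | hs
  · have hf : ⌊(n : ℝ) + s⌋ = n := by
      rw [Int.floor_intCast_add, Int.floor_eq_zero_iff.mpr ⟨s.2.1, hs⟩, add_zero]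
    have hu : unitFract ((n : ℝ) + s) = s := Subtype.ext (by
      simp only [unitFract, Int.fract_intCast_add]
      exact Int.fract_eq_self.mpr ⟨s.2.1, hs⟩)
    simp only [cover, hf, hu]
  · obtain rfl : s = 1 := Subtype.ext hs
    have hf : ⌊(n : ℝ) + (1 : unitInterval)⌋ = n + 1 := by simp
    have hu : unitFract ((n : ℝ) + (1 : unitInterval)) = 0 := Subtype.ext (by
      simp [unitFract])
    simp only [cover, hf, hu]
    rw [MappingTorus.mk_zero]
    rw [torusHomeo_apply, ← torusMap_mul, ← zpow_one_add]
    congr 4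
    ring

theorem continuous_mk : Continuous fun q : Torus × unitInterval =>
    MappingTorus.mk (torusHomeo A) q.1 q.2 :=
  continuous_quot_mk

theorem continuous_cover : Continuous (cover A) := by
  have hfin : LocallyFinite fun n : ℤ => (Prod.snd : (Fin 2 → ℝ) × ℝ → ℝ) ⁻¹' Set.Icc n (n + 1) :=
    (show LocallyFinite fun n : ℤ => Set.Icc (n : ℝ) (n + 1) from
      locallyFinite_Icc_of_tendsto tendsto_intCast_atTop_atTop
        (Filter.tendsto_atBot_add_const_right _ _
          (tendsto_intCast_atBot_iff.mpr Filter.tendsto_id))).preimage_continuous continuous_snd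
  refine hfin.continuous ?_ (fun n => isClosed_Icc.preimage continuous_snd) fun n => ?_
  · refine Set.eq_univ_of_forall fun e => Set.mem_iUnion.mpr ⟨⌊e.2⌋, Int.floor_le _, ?_⟩
    exact (Int.lt_floor_add_one _).le
  · have hc : Continuous fun e : (Fin 2 → ℝ) × ℝ => MappingTorus.mk (torusHomeo A)
        (torusMap (A ^ (-n)) (torusProj e.1)) (Set.projIcc 0 1 zero_le_one (e.2 - n)) :=
      (continuous_mk A).comp (((torusMap _).continuous.comp
        (isOpenQuotientMap_torusProj.continuous.comp continuous_fst)).prodMk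
        ((continuous_projIcc (h := zero_le_one)).comp (continuous_snd.sub continuous_const)))
    refine hc.continuousOn.congr fun e he => ?_
    have hmem : e.2 - n ∈ Set.Icc (0 : ℝ) 1 := ⟨by linarith [he.1], by linarith [he.2]⟩
    beta_reduce
    rw [Set.projIcc_of_mem _ hmem, ← cover_add]
    simp

theorem isQuotientMap_cover : Topology.IsQuotientMap (cover A) := by
  -- The restriction to the slab `ℝ² × [0, 1]` is already a quotient map.
  have hι : Continuous fun q : (Fin 2 → ℝ) × unitInterval => (q.1, (q.2 : ℝ)) := by fun_prop
  refine Topology.IsQuotientMap.of_comp hι (continuous_cover A) ?_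
  have hmk : Topology.IsQuotientMap (Quot.mk (GlueRel (torusHomeo A))) := isQuotientMap_quot_mk
  have hpr : Topology.IsQuotientMap (Prod.map torusProj (id : unitInterval → unitInterval)) :=
    (isOpenQuotientMap_torusProj.prodMap IsOpenQuotientMap.id).isQuotientMap
  convert! hmk.comp hpr using 1
  funext q
  have h := cover_add A q.1 0 q.2
  rw [Int.cast_zero, zero_add, neg_zero, zpow_zero, torusMap_one] at h
  exact h

theorem cover_smul (g : DeckGroup A) (e : (Fin 2 → ℝ) × ℝ) : cover A (g • e) = cover A e := by
  have hfl : ⌊e.2 + (g.right.toAdd : ℝ)⌋ = ⌊e.2⌋ + g.right.toAdd := Int.floor_add_intCast _ _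
  have hfr : unitFract (e.2 + (g.right.toAdd : ℝ)) = unitFract e.2 :=
    Subtype.ext (Int.fract_add_intCast _ _)
  have hp : torusProj (linAct (A ^ g.right.toAdd) e.1 + fun i => (g.left.toAdd i : ℝ)) =
      torusMap (A ^ g.right.toAdd) (torusProj e.1) := by
    rw [← torusProj_linAct, torusProj_eq_iff]
    exact ⟨_, rfl⟩
  simp only [cover, DeckGroup.smul_def, hfl, hfr, hp]
  rw [← torusMap_mul, ← zpow_add]
  congr 4
  ring

theorem exists_smul_eq_of_cover_eq {e e' : (Fin 2 → ℝ) × ℝ} (h : cover A e = cover A e') :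
    ∃ g : DeckGroup A, g • e' = e := by
  have hne : ∀ t : ℝ, unitFract t ≠ 1 := fun t ht =>
    (Int.fract_lt_one t).ne (congrArg Subtype.val ht)
  have hn := congrArg (MappingTorus.normalForm _) h
  simp only [cover, MappingTorus.normalForm_mk _ _ (hne _), Prod.mk.injEq] at hn
  obtain ⟨hx, ht⟩ := hn
  have hfr : Int.fract e.2 = Int.fract e'.2 := congrArg Subtype.val ht
  have hx' : torusProj e.1 = torusProj (linAct (A ^ (⌊e.2⌋ - ⌊e'.2⌋)) e'.1) := by
    have := congrArg (torusMap (A ^ ⌊e.2⌋)) hx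
    rw [← torusMap_mul, ← torusMap_mul, ← zpow_add, ← zpow_add, add_neg_cancel, zpow_zero,
      torusMap_one, ← sub_eq_add_neg] at this
    rw [this, torusProj_linAct]
  obtain ⟨w, hw⟩ := torusProj_eq_iff.mp hx'
  refine ⟨⟨.ofAdd w, .ofAdd (⌊e.2⌋ - ⌊e'.2⌋)⟩, ?_⟩
  rw [DeckGroup.smul_def]
  refine Prod.ext hw.symm ?_
  have h1 := Int.floor_add_fract e.2
  have h2 := Int.floor_add_fract e'.2
  simp only [toAdd_ofAdd, Int.cast_sub]
  linarith

theorem isQuotientCoveringMap_cover : IsQuotientCoveringMap (cover A) (DeckGroup A) where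
  __ := isQuotientMap_cover A
  continuous_const_smul g := by
    change Continuous fun e : (Fin 2 → ℝ) × ℝ =>
      (linAct (A ^ g.right.toAdd) e.1 + fun i => (g.left.toAdd i : ℝ), e.2 + (g.right.toAdd : ℝ))
    exact (((continuous_linAct _).comp continuous_fst).add continuous_const).prodMk
      (continuous_snd.add continuous_const)
  apply_eq_iff_mem_orbit := by
    refine ⟨fun h => exists_smul_eq_of_cover_eq A h, ?_⟩
    rintro ⟨g, rfl⟩
    exact cover_smul A g _
  disjoint e := by
    refine ⟨Metric.ball e (1 / 2), Metric.ball_mem_nhds e (by norm_num), ?_⟩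
    rintro g ⟨_, ⟨x, hx, rfl⟩, hgx⟩
    exact DeckGroup.eq_one_of_dist_lt hx hgx

theorem cover_zero : cover A 0 = base A := by
  have h := cover_add A 0 0 0
  rw [neg_zero, zpow_zero, torusMap_one] at h
  have h0 : ((0 : Fin 2 → ℝ), ((0 : ℤ) : ℝ) + ((0 : unitInterval) : ℝ)) = 0 := by
    simp
  rw [h0] at h
  exact h

/-- Precomposition with the isomorphism between `π₁(M(A))` and the opposite of the deck group; the
order of multiplication is irrelevant for homomorphisms to a commutative group. -/
theorem card_fundamentalGroup_hom (G : Type*) [CommGroup G] :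
    Nat.card (FundamentalGroup (TorusBundle A) (base A) →* G) = Nat.card (DeckGroup A →* G) := by
  have E : FundamentalGroup (TorusBundle A) (base A) ≃* (DeckGroup A)ᵐᵒᵖ :=
    (isQuotientCoveringMap_cover A).fundamentalGroupEquiv ⟨0, cover_zero A⟩
  refine Nat.card_congr (E.monoidHomCongrLeftEquiv.trans ?_)
  exact
    { toFun := fun f => ⟨⟨fun g => f (.op g), by simp⟩, fun g h => by
        simp only [MulOpposite.op_mul, map_mul]
        exact mul_comm _ _⟩
      invFun := fun f => ⟨⟨fun g => f g.unop, by simp⟩, fun g h => by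
        simp only [MulOpposite.unop_mul, map_mul]
        exact mul_comm _ _⟩
      left_inv := fun _ => rfl
      right_inv := fun _ => rfl }

end TorusBundle

end Covering

/-! ### Homomorphisms from the deck group to `ℤ/p` -/

section Homomorphisms

variable {p : ℕ}

theorem vecMul_linAct (A : SL(2, ℤ)) (a : Fin 2 → ZMod p) (w : Fin 2 → ℤ) :
    a ⬝ᵥ (fun i => ((linAct A w i : ℤ) : ZMod p)) =
      Matrix.vecMul a (Matrix.SpecialLinearGroup.map (Int.castRingHom (ZMod p)) A :
        Matrix (Fin 2) (Fin 2) (ZMod p)) ⬝ᵥ fun i => (w i : ZMod p) := by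
  rw [← linAct_intCast, linAct, Matrix.dotProduct_mulVec]

theorem vecMul_zpow_eq_self {R : Type*} [CommRing R] {B : SL(2, R)} {a : Fin 2 → R}
    (h : Matrix.vecMul a (B : Matrix (Fin 2) (Fin 2) R) = a) (n : ℤ) :
    Matrix.vecMul a ((B ^ n : SL(2, R)) : Matrix (Fin 2) (Fin 2) R) = a := by
  have hinv : Matrix.vecMul a ((B⁻¹ : SL(2, R)) : Matrix (Fin 2) (Fin 2) R) = a := by
    conv_lhs => rw [← h]
    rw [Matrix.vecMul_vecMul, ← Matrix.SpecialLinearGroup.coe_mul, mul_inv_cancel,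
      Matrix.SpecialLinearGroup.coe_one, Matrix.vecMul_one]
  induction n with
  | zero => simp
  | succ n ih =>
    rw [zpow_add_one, Matrix.SpecialLinearGroup.coe_mul, ← Matrix.vecMul_vecMul, ih, h]
  | pred n ih =>
    rw [zpow_sub_one, Matrix.SpecialLinearGroup.coe_mul, ← Matrix.vecMul_vecMul, ih, hinv]

/-- The homomorphism `ℤ² → ℤ/p` with values `a` on the standard basis. -/
def latticeHom (a : Fin 2 → ZMod p) : Multiplicative (Fin 2 → ℤ) →* Multiplicative (ZMod p) where
  toFun w := .ofAdd (a ⬝ᵥ fun i => (w.toAdd i : ZMod p))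
  map_one' := by simp [dotProduct]
  map_mul' v w := by
    rw [← ofAdd_add, ← dotProduct_add]
    congr 2
    funext i
    simp

theorem latticeHom_single (a : Fin 2 → ZMod p) (i : Fin 2) :
    latticeHom a (.ofAdd (Pi.single i 1)) = .ofAdd (a i) := by
  fin_cases i <;> simp [latticeHom, dotProduct]

theorem latticeHom_ext {f g : Multiplicative (Fin 2 → ℤ) →* Multiplicative (ZMod p)}
    (h : ∀ i, f (.ofAdd (Pi.single i 1)) = g (.ofAdd (Pi.single i 1))) : f = g := by
  have : f.toAdditive = g.toAdditive := by
    refine AddMonoidHom.functions_ext' _ _ _ fun i => ?_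
    ext
    exact h i
  exact MonoidHom.toAdditive.injective this

/-- The row vectors fixed by a matrix. -/
abbrev FixedRows {R : Type*} [CommRing R] (B : SL(2, R)) : Type _ :=
  {a : Fin 2 → R // Matrix.vecMul a (B : Matrix (Fin 2) (Fin 2) R) = a}

/-- A homomorphism from the deck group to `ℤ/p` is given by its values on the basis of `ℤ²`, which
form a row vector fixed by `A`, and by its value on the generator of `ℤ`. -/
def deckHomEquiv (A : SL(2, ℤ)) :
    (DeckGroup A →* Multiplicative (ZMod p)) ≃
      FixedRows (Matrix.SpecialLinearGroup.map (Int.castRingHom (ZMod p)) A) × ZMod p where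
  toFun f :=
    ⟨⟨fun i => (f (.inl (.ofAdd (Pi.single i 1)))).toAdd, by
      set a : Fin 2 → ZMod p := fun i => (f (.inl (.ofAdd (Pi.single i 1)))).toAdd with ha
      have hf : ∀ w, f (.inl w) = latticeHom a w := fun w =>
        DFunLike.congr_fun (latticeHom_ext (f := f.comp SemidirectProduct.inl) (g := latticeHom a) fun i => by
          rw [latticeHom_single]; rfl) w
      funext j
      -- Conjugation by the generator of `ℤ` acts on `ℤ²` by `A`, but is invisible in `ℤ/p`.
      have hconj := congrArg f (SemidirectProduct.inl_aut (φ := latticeAut.comp (zpowersHom _ A))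
        (.ofAdd 1) (.ofAdd (Pi.single j 1)))
      rw [map_mul, map_mul, map_inv, map_inv, mul_inv_cancel_comm, latticeAut_zpowersHom, hf, hf,
        latticeHom_single] at hconj
      have h2 := congrArg Multiplicative.toAdd hconj
      simp only [latticeHom, MonoidHom.coe_mk, OneHom.coe_mk, toAdd_ofAdd, zpow_one,
        vecMul_linAct] at h2
      rw [← h2]
      fin_cases j <;> simp [dotProduct]⟩,
    (f (.inr (.ofAdd 1))).toAdd⟩
  invFun q := SemidirectProduct.lift (latticeHom q.1.1)
    (zmultiplesHom (ZMod p) q.2).toMultiplicative fun n => by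
      refine MonoidHom.ext fun w => ?_
      simp only [MonoidHom.comp_apply, MulEquiv.coe_toMonoidHom, MulAut.conj_apply,
        mul_inv_cancel_comm]
      rw [← MonoidHom.comp_apply, latticeAut_zpowersHom]
      simp only [latticeHom, MonoidHom.coe_mk, OneHom.coe_mk, toAdd_ofAdd, vecMul_linAct, map_zpow]
      rw [vecMul_zpow_eq_self q.1.2]
  left_inv f := by
    refine SemidirectProduct.hom_ext ?_ ?_
    · rw [SemidirectProduct.lift_comp_inl]
      exact latticeHom_ext fun i => by rw [latticeHom_single]; rfl
    · rw [SemidirectProduct.lift_comp_inr]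
      ext
      simp
  right_inv q := by
    refine Prod.ext (Subtype.ext (funext fun i => ?_)) ?_
    · simp [latticeHom_single]
    · simp

/-- The free value on the generator of `ℤ` contributes the factor `p` that the normalisation of the
invariant cancels. -/
theorem Z_mk [NeZero p] (A : SL(2, ℤ)) :
    Z p (ConjClasses.mk A) =
      Nat.card (FixedRows (Matrix.SpecialLinearGroup.map (Int.castRingHom (ZMod p)) A)) := by
  change invariant (TorusBundle A) (TorusBundle.base A) (Multiplicative (ZMod p)) = _
  have hp : (p : ℚ) ≠ 0 := Nat.cast_ne_zero.mpr (NeZero.ne p)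
  rw [invariant, TorusBundle.card_fundamentalGroup_hom, Nat.card_congr (deckHomEquiv A),
    Nat.card_prod, Nat.card_congr (Multiplicative.toAdd (α := ZMod p)), Nat.card_zmod,
    Nat.cast_mul, mul_div_assoc, div_self hp, mul_one]

end Homomorphisms

/-! ### Fixed row vectors and conjugacy classes -/

section FixedRows

theorem card_fixedRows_congr {R : Type*} [CommRing R] {B C : SL(2, R)} (h : IsConj B C) :
    Nat.card (FixedRows B) = Nat.card (FixedRows C) := by
  obtain ⟨P, rfl⟩ := isConj_iff.mp h
  have cancel : ∀ {P Q : SL(2, R)}, P * Q = 1 → ∀ a : Fin 2 → R,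
      Matrix.vecMul (Matrix.vecMul a (P : Matrix (Fin 2) (Fin 2) R))
        (Q : Matrix (Fin 2) (Fin 2) R) = a := fun hPQ a => by
    rw [Matrix.vecMul_vecMul, ← Matrix.SpecialLinearGroup.coe_mul, hPQ,
      Matrix.SpecialLinearGroup.coe_one, Matrix.vecMul_one]
  refine Nat.card_congr
    { toFun := fun a => ⟨Matrix.vecMul a.1 (P⁻¹ : SL(2, R)).1, ?_⟩
      invFun := fun a => ⟨Matrix.vecMul a.1 P.1, ?_⟩
      left_inv := fun a => Subtype.ext (cancel (inv_mul_cancel P) a.1)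
      right_inv := fun a => Subtype.ext (cancel (mul_inv_cancel P) a.1) }
  · rw [Matrix.SpecialLinearGroup.coe_mul, Matrix.SpecialLinearGroup.coe_mul,
      ← Matrix.vecMul_vecMul, ← Matrix.vecMul_vecMul, cancel (inv_mul_cancel P), a.2]
  · have h := congrArg (fun v => Matrix.vecMul v P.1) a.2
    simpa only [Matrix.SpecialLinearGroup.coe_mul, ← Matrix.vecMul_vecMul,
      cancel (inv_mul_cancel P)] using h

variable {p : ℕ} [Fact p.Prime]

theorem card_fixedRows_one : Nat.card (FixedRows (1 : SL(2, ZMod p))) = p ^ 2 := by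
  rw [Nat.card_congr (Equiv.subtypeUnivEquiv fun a => by simp), Nat.card_fun, Nat.card_zmod,
    Nat.card_fin]

theorem card_fixedRows_unitriangular {b : ZMod p} (hb : b ≠ 0) :
    Nat.card (FixedRows (unitriangular b)) = p := by
  have key : ∀ a : Fin 2 → ZMod p,
      Matrix.vecMul a (unitriangular b : Matrix (Fin 2) (Fin 2) (ZMod p)) = a ↔ a 0 = 0 := by
    intro a
    rw [funext_iff, Fin.forall_fin_two]
    simp [unitriangular, Matrix.vecMul, dotProduct, hb]
  have e : FixedRows (unitriangular b) ≃ ZMod p :=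
    { toFun := fun a => a.1 1
      invFun := fun c => ⟨![0, c], (key _).mpr rfl⟩
      left_inv := fun a => Subtype.ext (funext fun i => by
        fin_cases i
        · exact ((key _).mp a.2).symm
        · rfl)
      right_inv := fun c => rfl }
  rw [Nat.card_congr e, Nat.card_zmod]

theorem isConj_unitriangular_sq_mul (d : (ZMod p)ˣ) (b : ZMod p) :
    IsConj (unitriangular b) (unitriangular ((d : ZMod p) ^ 2 * b)) := by
  obtain ⟨d, u, hd, -⟩ := d
  let D : SL(2, ZMod p) := ⟨Matrix.of ![![d, 0], ![0, u]], by simp [Matrix.det_fin_two, hd]⟩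
  refine isConj_iff.mpr ⟨D, ?_⟩
  rw [mul_inv_eq_iff_eq_mul]
  refine Subtype.ext ?_
  rw [Matrix.SpecialLinearGroup.coe_mul, Matrix.SpecialLinearGroup.coe_mul]
  ext i j
  fin_cases i <;> fin_cases j <;>
    simp [D, unitriangular, Matrix.mul_apply, Fin.sum_univ_two]
  linear_combination (-d * b) * hd

/-- Every unit is an even or an odd power of `ε`, so every unitriangular matrix is conjugate to
the identity or to one with corner `1` or `ε`. -/
theorem mk_unitriangular (ε : (ZMod p)ˣ) (hε : Subgroup.zpowers ε = ⊤) (b : ZMod p) :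
    ConjClasses.mk (unitriangular b) = C1 p ∨ ConjClasses.mk (unitriangular b) = C3 p ∨
      ConjClasses.mk (unitriangular b) = C4 p ε := by
  by_cases hb : b = 0
  · left
    have h1 : unitriangular b = 1 := by
      ext i j
      fin_cases i <;> fin_cases j <;> simp [unitriangular, hb]
    rw [h1, C1]
  right
  obtain ⟨k, hk⟩ : Units.mk0 b hb ∈ Subgroup.zpowers ε := hε ▸ Subgroup.mem_top _
  replace hk : ((ε ^ k : (ZMod p)ˣ) : ZMod p) = b := congrArg Units.val hk
  obtain ⟨m, rfl | rfl⟩ := k.even_or_odd'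
  · left
    refine Eq.trans ?_
      (ConjClasses.mk_eq_mk_iff_isConj.mpr (isConj_unitriangular_sq_mul (ε ^ m) 1)).symm
    rw [← hk, mul_comm 2 m, zpow_mul, zpow_ofNat, Units.val_pow_eq_pow_val, mul_one]
  · right
    refine Eq.trans ?_
      (ConjClasses.mk_eq_mk_iff_isConj.mpr (isConj_unitriangular_sq_mul (ε ^ m) ε)).symm
    rw [← hk, zpow_add_one, mul_comm 2 m, zpow_mul, zpow_ofNat, Units.val_mul,
      Units.val_pow_eq_pow_val]

/-- A non-zero vector over a field is the second row of a matrix of determinant one. -/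
theorem exists_specialLinearGroup_row {F : Type*} [Field F] {a : Fin 2 → F} (ha : a ≠ 0) :
    ∃ P : SL(2, F), P.1 1 = a := by
  by_cases h0 : a 0 = 0
  · have h1 : a 1 ≠ 0 := fun h1 => ha (funext fun i => by fin_cases i <;> assumption)
    refine ⟨⟨!![(a 1)⁻¹, 0; a 0, a 1], by simp [Matrix.det_fin_two, h1]⟩, ?_⟩
    funext i
    fin_cases i <;> rfl
  · refine ⟨⟨!![0, -(a 0)⁻¹; a 0, a 1], by simp [Matrix.det_fin_two, h0]⟩, ?_⟩
    funext i
    fin_cases i <;> rfl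

/-- If `P` has second row `a`, then the second row of `P B P⁻¹` is `a B P⁻¹ = a P⁻¹ = (0, 1)`, and
the determinant forces the remaining diagonal entry to be `1`. -/
theorem exists_isConj_unitriangular {F : Type*} [Field F] {B : SL(2, F)} {a : Fin 2 → F}
    (ha : a ≠ 0) (h : Matrix.vecMul a B.1 = a) : ∃ b, IsConj B (unitriangular b) := by
  obtain ⟨P, rfl⟩ := exists_specialLinearGroup_row ha
  set C : SL(2, F) := P * B * P⁻¹ with hC
  have hrow : C.1 1 = (1 : SL(2, F)).1 1 := by
    rw [← mul_inv_cancel P, hC, Matrix.SpecialLinearGroup.coe_mul,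
      Matrix.SpecialLinearGroup.coe_mul, Matrix.SpecialLinearGroup.coe_mul,
      Matrix.mul_apply_eq_vecMul, Matrix.mul_apply_eq_vecMul, h, Matrix.mul_apply_eq_vecMul]
  have h10 : C.1 1 0 = 0 := by simp [hrow]
  have h11 : C.1 1 1 = 1 := by simp [hrow]
  have h00 : C.1 0 0 = 1 := by
    have := C.2
    rwa [Matrix.det_fin_two, h10, h11, mul_one, mul_zero, sub_zero] at this
  refine ⟨C.1 0 1, isConj_iff.mpr ⟨P, ?_⟩⟩
  rw [← hC]
  ext i j
  fin_cases i <;> fin_cases j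
  · exact h00
  · rfl
  · exact h10
  · exact h11

theorem mk_eq_of_vecMul_eq_self (ε : (ZMod p)ˣ) (hε : Subgroup.zpowers ε = ⊤) {B : SL(2, ZMod p)}
    {a : Fin 2 → ZMod p} (ha : a ≠ 0) (h : Matrix.vecMul a B.1 = a) :
    ConjClasses.mk B = C1 p ∨ ConjClasses.mk B = C3 p ∨ ConjClasses.mk B = C4 p ε := by
  obtain ⟨b, hb⟩ := exists_isConj_unitriangular ha h
  rw [ConjClasses.mk_eq_mk_iff_isConj.mpr hb]
  exact mk_unitriangular ε hε b

end FixedRows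

end DijkgraafWitten

theorem corollary3p3 (p : ℕ) [Fact p.Prime] (hp : p ≠ 2)
    (ε : (ZMod p)ˣ) (hε : Subgroup.zpowers ε = ⊤) (c : ConjClasses SL(2, ℤ)) :
    (DijkgraafWitten.reduceMod p c = DijkgraafWitten.C1 p →
      DijkgraafWitten.Z p c = (p : ℚ) ^ 2) ∧
    ((DijkgraafWitten.reduceMod p c = DijkgraafWitten.C3 p ∨
        DijkgraafWitten.reduceMod p c = DijkgraafWitten.C4 p ε) →
      DijkgraafWitten.Z p c = (p : ℚ)) ∧
    (¬ (DijkgraafWitten.reduceMod p c = DijkgraafWitten.C1 p ∨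
        DijkgraafWitten.reduceMod p c = DijkgraafWitten.C3 p ∨
        DijkgraafWitten.reduceMod p c = DijkgraafWitten.C4 p ε) →
      DijkgraafWitten.Z p c = 1) := by
  open DijkgraafWitten in
  obtain ⟨A, rfl⟩ := ConjClasses.mk_surjective c
  have hmk : reduceMod p (ConjClasses.mk A) =
    ConjClasses.mk (Matrix.SpecialLinearGroup.map (Int.castRingHom (ZMod p)) A) := rfl
  rw [Z_mk, hmk]
  refine ⟨fun h => ?_, fun h => ?_, fun h => ?_⟩
  · rw [card_fixedRows_congr (ConjClasses.mk_eq_mk_iff_isConj.mp h), card_fixedRows_one,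
      Nat.cast_pow]
  · rcases h with h | h
    · rw [card_fixedRows_congr (ConjClasses.mk_eq_mk_iff_isConj.mp h),
        card_fixedRows_unitriangular one_ne_zero]
    · rw [card_fixedRows_congr (ConjClasses.mk_eq_mk_iff_isConj.mp h),
        card_fixedRows_unitriangular ε.ne_zero]
  · rw [Nat.cast_eq_one, Nat.card_eq_one_iff_exists]
    refine ⟨⟨0, Matrix.zero_vecMul _⟩, fun a => Subtype.ext (by_contra fun ha => ?_)⟩
    exact h (mk_eq_of_vecMul_eq_self ε hε ha a.2)
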